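/- Let $k$ be a perfect field of characteristic $p>0$, let $R$ be a nonzero commutative ring which is of finite type over $k$ or a localization of such a ring, and put $X=\operatorname{Spec} R$. Fix an integer $e\ge 1$. Write $F^e_*R$ for $R$ regarded as an $R$-module via the $e$-fold iterated Frobenius, so that $r\cdot F^e_*x=F^e_*(r^{p^e}x)$, and let $\phi:F^e_*R\to R$ be $R$-linear. An ideal $J\subseteq R$ is called $\phi$-compatible if $\phi(F^e_*J)\subseteq J$. For $t\ge 1$ let $\phi^t:F^{te}_*R\to R$ be the composition $$F^{te}_*R\xrightarrow{F^{(t-1)e}_*\phi}F^{(t-1)e}_*R\to\cdots\xrightarrow{F^e_*\phi}F^e_*R\xrightarrow{\phi}R .$$ (d) If $J$ is $\phi$-compatible, then $J$ is $\phi^t$-compatible for every $t\ge1$. If $\phi$ is surjective, then for every $t\ge 1$ every $\phi^t$-compatible ideal is $\phi$-compatible. (e) Suppose that $\phi$ is surjective and $R$ is a domain. Let $\operatorname{Sing}X$ be the set of points of $X$ whose local ring is not regular. Let $D_\phi$ be the effective divisor on the normal locus of $X$ defined by $\phi$, that is, the divisor of zeros of $\phi$ as a section of $\mathcal Hom(F^e_*\mathcal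 O_X,\mathcal O_X)$, a sheaf of $F^e_*\mathcal O_X$-modules that is reflexive of rank one on the normal locus: its coefficient at a height-one prime $P$ with $R_P$ normal is the length over the ring $F^e_*R_P$ of $\operatorname{Hom}_{R_P}(F^e_*R_P,R_P)/(F^e_*R_P)\phi$. Let $\operatorname{Supp}D_\phi\subseteq X$ be the union of the sets $V(P)$ over the primes $P$ at which this coefficient is nonzero. Let $\mathfrak a\ne0$ be any ideal of $R$ that vanishes on $\operatorname{Supp}D_\phi\cup\operatorname{Sing}X$, i.e. $\operatorname{Supp}D_\phi\cup\operatorname{Sing}X\subseteq V(\mathfrak a)$. Then $$\phi(F^e_*\mathfrak a)\subseteq\phi^2(F^{2e}_*\mathfrak a)\subseteq\phi^3(F^{3e}_*\mathfrak a)\subseteq\cdots,$$ this chain stabilizes, and its stable value is the unique smallest nonzero $\phi$-compatible ideal of $R$: it is nonzero and $\phi$-compatible, and it is contained in every nonzero $\phi$-compatible ideal. -/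

import Mathlib

noncomputable section

/-- `F^e_* R`: the ring `R`, viewed as an `R`-module through the `e`-fold iterated Frobenius. -/
def FrobPush (_p _e : ℕ) (R : Type*) : Type _ := R

namespace FrobPush

variable {p e : ℕ} {R : Type*} [CommRing R]

instance : CommRing (FrobPush p e R) := inferInstanceAs (CommRing R)

/-- The identity map `r ↦ F^e_* r`, an isomorphism of rings (not of `R`-modules). -/
def of (p e : ℕ) (R : Type*) [CommRing R] : R ≃+* FrobPush p e R := RingEquiv.refl R

/-- The `R`-module structure `r • F^e_* x = F^e_* (r ^ (p ^ e) * x)`. -/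
instance [ExpChar R p] : Module R (FrobPush p e R) :=
  Module.compHom (FrobPush p e R) ((of p e R).toRingHom.comp (iterateFrobenius R p e))

theorem smul_of [ExpChar R p] (r x : R) :
    r • of p e R x = of p e R (r ^ p ^ e * x) := rfl

/-- For an ideal `J` of `R`, the `R`-submodule `F^e_* J` of `F^e_* R`. -/
def ideal (p e : ℕ) [ExpChar R p] (J : Ideal R) : Submodule R (FrobPush p e R) where
  carrier := {x | (of p e R).symm x ∈ J}
  zero_mem' := J.zero_mem
  add_mem' hx hy := J.add_mem hx hy
  smul_mem' r _ hx := J.mul_mem_left (r ^ p ^ e) hx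

/-- The `F^e_* R`-module structure on `Hom_R(F^e_* R, R)`: `(s • φ)(x) = φ (s * x)`. -/
instance [ExpChar R p] : Module (FrobPush p e R) (FrobPush p e R →ₗ[R] R) where
  smul s φ :=
    { toFun := fun x => φ (s * x)
      map_add' := fun x y => by rw [mul_add, map_add]
      map_smul' := fun r x => by
        have h : s * r • x = r • (s * x) :=
          mul_left_comm s ((of p e R) (iterateFrobenius R p e r)) x
        rw [h, map_smul, RingHom.id_apply] }
  one_smul φ := LinearMap.ext fun x => congrArg φ (one_mul x)
  mul_smul s t φ := LinearMap.ext fun x => congrArg φ (by ring)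
  smul_zero _ := rfl
  smul_add _ _ _ := rfl
  add_smul s t φ := LinearMap.ext fun x =>
    (congrArg φ (add_mul s t x)).trans (map_add φ _ _)
  zero_smul φ := LinearMap.ext fun x => (congrArg φ (zero_mul x)).trans (map_zero φ)

theorem smul_hom_apply [ExpChar R p] (s : FrobPush p e R) (φ : FrobPush p e R →ₗ[R] R)
    (x : FrobPush p e R) : (s • φ) x = φ (s * x) := rfl

/-- The ideal `φ(F^e_* J)` of `R`. -/
def image [ExpChar R p] (φ : FrobPush p e R →ₗ[R] R) (J : Ideal R) : Ideal R :=
  Submodule.map φ (ideal p e J)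

/-- The ideal `J` is `φ`-compatible: `φ(F^e_* J) ⊆ J`. -/
def Compatible [ExpChar R p] (φ : FrobPush p e R →ₗ[R] R) (J : Ideal R) : Prop :=
  image φ J ≤ J

theorem iterate_add_smul [ExpChar R p] (φ : FrobPush p e R →ₗ[R] R) (t : ℕ) :
    (∀ x y : R, (fun z : R => φ (of p e R z))^[t] (x + y) =
      (fun z : R => φ (of p e R z))^[t] x + (fun z : R => φ (of p e R z))^[t] y) ∧
    (∀ r x : R, (fun z : R => φ (of p e R z))^[t] (r ^ p ^ (t * e) * x) =
      r * (fun z : R => φ (of p e R z))^[t] x) := by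
  induction t with
  | zero => simp
  | succ t ih =>
    refine ⟨fun x y => ?_, fun r x => ?_⟩
    · simp only [Function.iterate_succ_apply]
      rw [map_add, map_add, ih.1]
    · simp only [Function.iterate_succ_apply]
      have h : r ^ p ^ ((t + 1) * e) * x = (r ^ p ^ (t * e)) ^ p ^ e * x := by
        rw [← pow_mul, ← pow_add, add_mul, one_mul]
      rw [h, ← smul_of, map_smul, smul_eq_mul, ih.2]

/-- The composition `φ^t : F^{te}_* R → F^{(t-1)e}_* R → ⋯ → F^e_* R → R` of the maps
`F^{(t-1)e}_* φ, …, F^e_* φ, φ`. Each of these has the same underlying map of sets as `φ`,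
so the underlying map of `φ^t` is the `t`-fold iterate of that of `φ`. -/
def iter [ExpChar R p] (φ : FrobPush p e R →ₗ[R] R) (t : ℕ) :
    FrobPush p (t * e) R →ₗ[R] R where
  toFun x := (fun z : R => φ (of p e R z))^[t] ((of p (t * e) R).symm x)
  map_add' _ _ := (iterate_add_smul φ t).1 _ _
  map_smul' r _ := (iterate_add_smul φ t).2 r _

end FrobPush

/-- The order of vanishing at the prime `P` of a global section `s` of the sheaf associated with
the `A`-module `M`: the length over `A_P` of `M_P / A_P s`. When `A_P` is a discrete valuation
ring and `M_P` is free of rank one with generator `g`, and `s = z g` in `M_P`, this is the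
valuation of `z`. -/
def sectionOrd {A M : Type*} [CommRing A] [AddCommGroup M] [Module A M] (s : M)
    (P : Ideal A) [P.IsPrime] : ℕ∞ :=
  Module.length (Localization.AtPrime P)
    (LocalizedModule P.primeCompl (M ⧸ Submodule.span A {s}))

/-- The points of codimension one of the normal locus of `Spec R`. -/
def NormalPrimeDivisor (R : Type*) [CommRing R] : Type _ :=
  {P : PrimeSpectrum R //
    P.asIdeal.height = 1 ∧ IsIntegrallyClosed (Localization.AtPrime P.asIdeal)}

/-- The effective divisor `D_φ` on the normal locus of `Spec R`, for a domain `R`: the divisor of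
zeros of `φ`, as a section of the sheaf of `F^e_* O`-modules `Hom(F^e_* O, O)`, which on the normal
locus is reflexive of rank one, isomorphic to `O((1 - p^e) K)`. A prime `P` of `R` is regarded as
a prime of the ring `F^e_* R`, which is `R`. The coefficients are finite when `φ ≠ 0`. -/
def frobDivisor {p e : ℕ} {R : Type*} [CommRing R] [ExpChar R p]
    (φ : FrobPush p e R →ₗ[R] R) (P : NormalPrimeDivisor R) : ℕ∞ :=
  sectionOrd φ (P.1.asIdeal.comap (FrobPush.of p e R).symm)

/-- The support of `D_φ` in `Spec R`: the union of the closures of the codimension one points at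
which the coefficient of `D_φ` is not zero. -/
def frobDivisorSupp {p e : ℕ} {R : Type*} [CommRing R] [ExpChar R p]
    (φ : FrobPush p e R →ₗ[R] R) : Set (PrimeSpectrum R) :=
  ⋃ (P : NormalPrimeDivisor R) (_ : frobDivisor φ P ≠ 0),
    PrimeSpectrum.zeroLocus (P.1.asIdeal : Set R)

/-- The singular locus (the non-regular locus) of `Spec R`. -/
def singLocus (R : Type*) [CommRing R] : Set (PrimeSpectrum R) :=
  {x | ¬ IsRegularLocalRing (Localization.AtPrime x.asIdeal)}

end

/-! Write `q = p ^ e`. If `φ y = 1`, then `r = φ (r ^ q * y)`. Hence `J ⊆ φ(J)` for every ideal `J`,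
and every compatible ideal is radical. The chain therefore ascends from `a`, and by noetherianity it
stabilizes at a nonzero compatible ideal.

Minimality reduces to `a ⊆ J` for each nonzero compatible `J`, since then `φ^t(a) ⊆ φ^t(J) ⊆ J`. As
`J` is radical, it suffices that every prime `P ⊇ J` contains `a`. Otherwise `P`, and every prime
below it, is a regular point off the support of `D_φ`, and two facts force `J = 0`. (1) `φ`
generates `Hom(F^e_* R, R)` at `P`. This module has rank one, so the denominators of `ψ / φ` form a
colon ideal of a principal ideal. If that ideal lay in `P`, an associated prime below `P` would have
height one by regularity, and `D_φ` would have a nonzero coefficient there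
(`exists_smul_eq_smul_of_notMem`). (2) By Kunz, `F^e_* R_P` is free. By (1) its coordinate functions
carry `J` into `J R_P`, so `J R_P ⊆ (J R_P)^[q] ⊆ (J R_P)^2`, and Nakayama applies
(`Compatible.eq_bot_of_le`). -/

namespace FrobPush

/-! ### Images, compatibility and iterates -/

variable {p e : ℕ} {R : Type*} [CommRing R] [ExpChar R p]

theorem mem_image {φ : FrobPush p e R →ₗ[R] R} {J : Ideal R} {y : R} :
    y ∈ image φ J ↔ ∃ x ∈ J, φ (of p e R x) = y := Iff.rfl

theorem compatible_iff {φ : FrobPush p e R →ₗ[R] R} {J : Ideal R} :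
    Compatible φ J ↔ ∀ x ∈ J, φ (of p e R x) ∈ J :=
  ⟨fun h x hx => h (mem_image.2 ⟨x, hx, rfl⟩), fun h _ hy => by
    obtain ⟨x, hx, rfl⟩ := mem_image.1 hy
    exact h x hx⟩

theorem apply_pow_mul (φ : FrobPush p e R →ₗ[R] R) (r x : R) :
    φ (of p e R (r ^ p ^ e * x)) = r * φ (of p e R x) := by
  rw [← smul_of, map_smul, smul_eq_mul]

theorem image_mono (φ : FrobPush p e R →ₗ[R] R) {I J : Ideal R} (h : I ≤ J) :
    image φ I ≤ image φ J := fun _ hy => by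
  obtain ⟨x, hx, rfl⟩ := mem_image.1 hy
  exact mem_image.2 ⟨x, h hx, rfl⟩

theorem iter_apply (φ : FrobPush p e R →ₗ[R] R) (t : ℕ) (x : R) :
    iter φ t (of p (t * e) R x) = (fun z : R => φ (of p e R z))^[t] x := rfl

theorem image_iter_one (φ : FrobPush p e R →ₗ[R] R) (J : Ideal R) :
    image (iter φ 1) J = image φ J := by
  ext y
  rfl

theorem image_iter_zero (φ : FrobPush p e R →ₗ[R] R) (J : Ideal R) :
    image (iter φ 0) J = J := by
  ext y
  exact ⟨fun ⟨x, hx, h⟩ => h ▸ hx, fun h => ⟨y, h, rfl⟩⟩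

theorem image_iter_succ (φ : FrobPush p e R →ₗ[R] R) (t : ℕ) (J : Ideal R) :
    image (iter φ (t + 1)) J = image φ (image (iter φ t) J) := by
  ext y
  constructor
  · rintro ⟨x, hx, rfl⟩
    exact mem_image.2 ⟨_, mem_image.2 ⟨x, hx, rfl⟩,
      (Function.iterate_succ_apply' (fun z : R => φ (of p e R z)) t x).symm⟩
  · intro h
    obtain ⟨z, hz, rfl⟩ := mem_image.1 h
    obtain ⟨x, hx, rfl⟩ := mem_image.1 hz
    exact mem_image.2 ⟨x, hx, Function.iterate_succ_apply' (fun z : R => φ (of p e R z)) t x⟩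

theorem Compatible.iter {φ : FrobPush p e R →ₗ[R] R} {J : Ideal R} (h : Compatible φ J) (t : ℕ) :
    Compatible (iter φ t) J := by
  induction t with
  | zero => exact (image_iter_zero φ J).le
  | succ t ih => exact (image_iter_succ φ t J).le.trans ((image_mono φ ih).trans h)

theorem le_image_of_surjective {φ : FrobPush p e R →ₗ[R] R} (hφ : Function.Surjective φ)
    (J : Ideal R) : J ≤ image φ J := by
  intro r hr
  obtain ⟨y, hy⟩ := hφ 1
  refine mem_image.2 ⟨r ^ p ^ e * (of p e R).symm y, J.mul_mem_right _
    (J.pow_mem_of_mem hr _ (pow_pos (expChar_pos R p) e)), ?_⟩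
  rw [apply_pow_mul, RingEquiv.apply_symm_apply, hy, mul_one]

theorem monotone_image_iter {φ : FrobPush p e R →ₗ[R] R} (hφ : Function.Surjective φ)
    (J : Ideal R) : Monotone fun t => image (iter φ t) J :=
  monotone_nat_of_le_succ fun t => by
    rw [image_iter_succ]
    exact le_image_of_surjective hφ _

/-- Surjectivity gives `φ(J) ⊆ φ^t(J) ⊆ J`. -/
theorem compatible_of_compatible_iter {φ : FrobPush p e R →ₗ[R] R} (hφ : Function.Surjective φ)
    {t : ℕ} (ht : 0 < t) {J : Ideal R} (h : Compatible (iter φ t) J) : Compatible φ J := by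
  have h1 := monotone_image_iter hφ J (show 1 ≤ t from ht)
  simp only [image_iter_one] at h1
  exact h1.trans h

theorem Compatible.isRadical {φ : FrobPush p e R →ₗ[R] R} (hφ : Function.Surjective φ)
    (hpe : 1 < p ^ e) {J : Ideal R} (h : Compatible φ J) : J.IsRadical := by
  refine (Ideal.isRadical_iff_pow_one_lt _ hpe).2 fun r hr => ?_
  obtain ⟨y, hy⟩ := hφ 1
  have := compatible_iff.1 h _ (J.mul_mem_right ((of p e R).symm y) hr)
  rwa [apply_pow_mul, RingEquiv.apply_symm_apply, hy, mul_one] at this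

/-- Torsion-freeness over `F^e_* R`: a multiple of `u` is `u ^ p ^ e`, which acts on `φ` as a scalar
of `R`. -/
theorem exists_smul_ne_zero [IsDomain R] {φ : FrobPush p e R →ₗ[R] R} (hφ : φ ≠ 0)
    {u : FrobPush p e R} (hu : u ≠ 0) : u • φ ≠ 0 := by
  intro h
  refine hφ (LinearMap.ext fun x => ?_)
  set r := (of p e R).symm u
  have hr : r ≠ 0 := by simpa [r] using hu
  obtain ⟨n, hn⟩ := Nat.exists_eq_succ_of_ne_zero (pow_pos (expChar_pos R p) e).ne'
  have h2 : (u • φ) (of p e R (r ^ n * (of p e R).symm x)) = r * φ x := by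
    rw [smul_hom_apply]
    have : u * of p e R (r ^ n * (of p e R).symm x)
        = of p e R (r ^ p ^ e * (of p e R).symm x) := by
      rw [hn, pow_succ', mul_assoc, map_mul (of p e R) r]
      simp [r]
    rw [this, apply_pow_mul, RingEquiv.apply_symm_apply]
  rw [h, LinearMap.zero_apply] at h2
  simpa [hr] using h2.symm

end FrobPush

/-! ### Rank one of the Frobenius dual -/

/-- A form vanishing on a maximal independent family vanishes, because the quotient by its span is
torsion. -/
theorem finrank_dual_le_finrank {R M : Type*} [CommRing R] [IsDomain R] [IsNoetherianRing R]
    [AddCommGroup M] [Module R M] [Module.Finite R M] :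
    Module.finrank R (Module.Dual R M) ≤ Module.finrank R M := by
  obtain ⟨b, hb⟩ := exists_linearIndependent_of_le_finrank (le_refl (Module.finrank R M))
  set N := Submodule.span R (Set.range b)
  have hN : Module.finrank R N = Module.finrank R M := by
    rw [finrank_span_eq_card hb, Fintype.card_fin]
  have hq : Module.finrank R (M ⧸ N) = 0 := by
    have := Submodule.finrank_quotient_add_finrank N
    omega
  let E : Module.Dual R M →ₗ[R] (Fin (Module.finrank R M) → R) :=
    LinearMap.pi fun i => Module.Dual.eval R M (b i)
  have hE : Function.Injective E := by
    rw [injective_iff_map_eq_zero]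
    intro ψ hψ
    have hker : N ≤ LinearMap.ker ψ := by
      rw [Submodule.span_le]
      rintro _ ⟨i, rfl⟩
      exact congrFun hψ i
    ext x
    obtain ⟨a, ha, hax⟩ := Module.finrank_eq_zero_iff.1 hq (Submodule.Quotient.mk x)
    rw [← Submodule.Quotient.mk_smul, Submodule.Quotient.mk_eq_zero] at hax
    have := hker hax
    rw [LinearMap.mem_ker, map_smul, smul_eq_mul] at this
    exact (mul_eq_zero.1 this).resolve_left ha
  simpa using LinearMap.finrank_le_finrank_of_injective hE

namespace FrobPush

/-- For an `F`-finite domain, `Hom_R(F^e_* R, R)` has rank one over `F^e_* R`: every element has a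
nonzero multiple that is a multiple of a given nonzero `φ`. -/
theorem exists_smul_eq_smul {p e : ℕ} {R : Type*} [CommRing R] [ExpChar R p] [IsDomain R]
    [IsNoetherianRing R] [Module.Finite R (FrobPush p e R)] {φ : FrobPush p e R →ₗ[R] R}
    (hφ : φ ≠ 0) (ψ : FrobPush p e R →ₗ[R] R) :
    ∃ s u : FrobPush p e R, s ≠ 0 ∧ s • ψ = u • φ := by
  -- The injection `u ↦ u • φ` into a module of no larger rank has torsion cokernel.
  let μ : FrobPush p e R →ₗ[R] Module.Dual R (FrobPush p e R) :=
    { toFun := fun u => u • φ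
      map_add' := fun u v => add_smul u v φ
      map_smul' := fun r u => by
        ext x
        have h : (r • u) * x = r • (u * x) := mul_assoc _ _ _
        rw [smul_hom_apply, h, map_smul]
        rfl }
  have hμ : Function.Injective μ := by
    rw [injective_iff_map_eq_zero]
    intro u hu
    by_contra h
    exact exists_smul_ne_zero hφ h hu
  have h1 := Submodule.finrank_quotient_add_finrank (LinearMap.range μ)
  have h2 := LinearMap.finrank_range_of_inj hμ
  have h3 := finrank_dual_le_finrank (R := R) (M := FrobPush p e R)
  have hq : Module.finrank R (Module.Dual R (FrobPush p e R) ⧸ LinearMap.range μ) = 0 := by omega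
  obtain ⟨r, hr, hrψ⟩ := Module.finrank_eq_zero_iff.1 hq (Submodule.Quotient.mk ψ)
  rw [← Submodule.Quotient.mk_smul, Submodule.Quotient.mk_eq_zero] at hrψ
  obtain ⟨u, hu⟩ := hrψ
  refine ⟨of p e R (r ^ p ^ e), u, ?_, ?_⟩
  · rw [Ne, map_eq_zero_iff _ (of p e R).injective]
    exact pow_ne_zero _ hr
  · refine Eq.trans ?_ hu.symm
    ext x
    exact apply_pow_mul ψ r x

end FrobPush

/-! ### Regular local rings -/

namespace IsRegularLocalRing

open IsLocalRing

variable {A : Type*} [CommRing A]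

/-- Exchange: since `x` is not in the square, some coefficient in its expansion over minimal
generators is a unit. -/
theorem exists_card_span_insert_eq_maximalIdeal [IsLocalRing A] [IsNoetherianRing A] {n : ℕ}
    (hA : (maximalIdeal A).spanFinrank = n + 1) {x : A} (hx : x ∈ maximalIdeal A)
    (hx2 : x ∉ maximalIdeal A ^ 2) :
    ∃ S : Finset A, S.card = n ∧ Ideal.span (insert x (S : Set A)) = maximalIdeal A := by
  classical
  have fg : (maximalIdeal A).FG := (maximalIdeal A).fg_of_isNoetherianRing
  have hfin := Submodule.FG.finite_generators fg
  set G : Finset A := hfin.toFinset with hG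
  have hcard : G.card = n + 1 := by
    rw [← hA, ← Submodule.FG.generators_ncard fg, Set.ncard_eq_toFinset_card _ hfin]
  have hspan : Ideal.span (G : Set A) = maximalIdeal A := by
    rw [hG, Set.Finite.coe_toFinset]
    exact (maximalIdeal A).span_generators
  have hGm : ∀ y ∈ G, y ∈ maximalIdeal A := fun y hy => hspan ▸ Ideal.subset_span hy
  obtain ⟨f, -, hf⟩ := Submodule.mem_span_finset.1 (hspan.symm ▸ hx : x ∈ Ideal.span (G : Set A))
  obtain ⟨s, hs, hfs⟩ : ∃ s ∈ G, IsUnit (f s) := by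
    by_contra! h
    refine hx2 ?_
    rw [← hf, pow_two]
    exact Ideal.sum_mem _ fun y hy =>
      Ideal.mul_mem_mul ((mem_maximalIdeal _).2 (h y hy)) (hGm y hy)
  refine ⟨G.erase s, by rw [Finset.card_erase_of_mem hs, hcard, Nat.add_sub_cancel], ?_⟩
  refine le_antisymm (Ideal.span_le.2 ?_) ?_
  · rintro y (rfl | hy)
    · exact hx
    · exact hGm y (Finset.mem_of_mem_erase hy)
  · rw [← hspan, Ideal.span_le]
    intro y hy
    by_cases hys : y = s
    · subst hys
      have h1 : f y * y = x - ∑ z ∈ G.erase y, f z * z := by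
        rw [← hf, ← Finset.add_sum_erase _ _ hs]
        simp
      refine (Ideal.unit_mul_mem_iff_mem _ hfs).1 (h1 ▸ Ideal.sub_mem _
        (Ideal.subset_span (Set.mem_insert _ _)) (Ideal.sum_mem _ fun z hz =>
          Ideal.mul_mem_left _ _ (Ideal.subset_span (Set.mem_insert_of_mem _ hz))))
    · exact Ideal.subset_span (Set.mem_insert_of_mem _ (Finset.mem_erase.2 ⟨hys, hy⟩))

theorem quotient_span_singleton [IsRegularLocalRing A] {n : ℕ}
    (hA : ringKrullDim A = (n + 1 : ℕ)) {x : A} (hx : x ∈ maximalIdeal A)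
    (hx2 : x ∉ maximalIdeal A ^ 2) :
    IsRegularLocalRing (A ⧸ Ideal.span {x}) ∧ ringKrullDim (A ⧸ Ideal.span {x}) = n := by
  classical
  have hne : Ideal.span {x} ≠ ⊤ := by
    rwa [Ne, Ideal.span_singleton_eq_top, ← mem_nonunits_iff, ← mem_maximalIdeal]
  have : Nontrivial (A ⧸ Ideal.span {x}) := Ideal.Quotient.nontrivial_iff.2 hne
  have hloc : IsLocalRing (A ⧸ Ideal.span {x}) :=
    IsLocalRing.of_surjective' (Ideal.Quotient.mk _) Ideal.Quotient.mk_surjective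
  have hfr : (maximalIdeal A).spanFinrank = n + 1 := by
    have := (isRegularLocalRing_iff A).1 ‹_›
    rw [hA] at this
    exact_mod_cast this
  obtain ⟨S, hS, hspan⟩ := exists_card_span_insert_eq_maximalIdeal hfr hx hx2
  have hmax : maximalIdeal (A ⧸ Ideal.span {x}) =
      Ideal.span ((Ideal.Quotient.mk (Ideal.span {x})) '' (S : Set A)) := by
    have h1 : (maximalIdeal A).map (Ideal.Quotient.mk (Ideal.span {x})) =
        maximalIdeal (A ⧸ Ideal.span {x}) := by
      exact IsLocalRing.map_maximalIdeal_of_surjective _ Ideal.Quotient.mk_surjective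
    rw [← h1, ← hspan, Ideal.map_span, Set.image_insert_eq,
      Ideal.Quotient.eq_zero_iff_mem.2 (Ideal.mem_span_singleton_self x), Ideal.span_insert_zero]
  have hle : (maximalIdeal (A ⧸ Ideal.span {x})).spanFinrank ≤ n := by
    rw [hmax]
    refine (Submodule.spanFinrank_span_le_ncard_of_finite (S.finite_toSet.image _)).trans ?_
    refine (Set.ncard_image_le S.finite_toSet).trans ?_
    rw [Set.ncard_coe_finset, hS]
  have hdim : ((n : ℕ) : WithBot ℕ∞) ≤ ringKrullDim (A ⧸ Ideal.span {x}) := by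
    have h1 := ringKrullDim_le_ringKrullDim_quotient_add_card (R := A) {x}
      (by simpa [ringJacobson_eq_maximalIdeal] using hx)
    rw [hA, Finset.coe_singleton, Finset.card_singleton] at h1
    push_cast at h1
    exact ENat.WithBot.add_le_add_natCast_right_iff.mp h1
  have hle' : ((maximalIdeal (A ⧸ Ideal.span {x})).spanFinrank : WithBot ℕ∞) ≤ n := by
    exact_mod_cast hle
  have hreg := of_spanFinrank_maximalIdeal_le _ (hle'.trans hdim)
  exact ⟨hreg, le_antisymm (((isRegularLocalRing_iff _).1 hreg) ▸ hle') hdim⟩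

/-- Prime avoidance, which tolerates the non-prime ideal `maximalIdeal A ^ 2`. -/
theorem exists_mem_maximalIdeal_notMem [IsLocalRing A] [IsNoetherianRing A] {n : ℕ}
    (hA : ringKrullDim A = (n + 1 : ℕ)) :
    ∃ x ∈ maximalIdeal A, x ∉ maximalIdeal A ^ 2 ∧ ∀ Q ∈ minimalPrimes A, x ∉ Q := by
  classical
  have hfin : (minimalPrimes A).Finite := minimalPrimes.finite_of_isNoetherianRing A
  by_contra! h
  let f : Ideal A → Ideal A := fun Q => Q
  have hsub : ((maximalIdeal A : Ideal A) : Set A) ⊆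
      ⋃ Q ∈ (↑(insert (maximalIdeal A ^ 2) hfin.toFinset) : Set (Ideal A)), (f Q : Set A) := by
    intro x hx
    by_cases hx2 : x ∈ maximalIdeal A ^ 2
    · exact Set.mem_biUnion (by simp) hx2
    · obtain ⟨Q, hQ, hxQ⟩ := h x hx hx2
      exact Set.mem_biUnion (by simp [hQ]) hxQ
  have hdim0 : ¬ (maximalIdeal A).height = 0 := by
    intro h0
    have := maximalIdeal_height_eq_ringKrullDim (R := A)
    rw [h0, hA] at this
    exact absurd this (by norm_cast)
  obtain ⟨Q, hQ, hle⟩ := (Ideal.subset_union_prime (maximalIdeal A ^ 2) (maximalIdeal A ^ 2)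
    (fun Q hQ hne _ => by
      have hQ' : Q ∈ minimalPrimes A := by simpa [hne] using hQ
      exact hQ'.1.1)).1 hsub
  have hprime : ∀ Q : Ideal A, Q ∈ minimalPrimes A → maximalIdeal A ≤ Q → False := by
    intro Q hQ hle
    have hQp : Q.IsPrime := hQ.1.1
    have : Q = maximalIdeal A := le_antisymm (le_maximalIdeal hQp.ne_top) hle
    subst this
    exact hdim0 (Ideal.height_eq_zero_iff.2 hQ)
  rcases Finset.mem_insert.1 hQ with rfl | hQ
  · have hbot : maximalIdeal A = ⊥ := by
      refine Submodule.eq_bot_of_le_smul_of_le_jacobson_bot (maximalIdeal A) _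
        (maximalIdeal A).fg_of_isNoetherianRing ?_ (maximalIdeal_le_jacobson _)
      rw [smul_eq_mul, ← pow_two]
      exact hle
    obtain ⟨Q, hQ, -⟩ := Ideal.exists_minimalPrimes_le (bot_le : (⊥ : Ideal A) ≤ maximalIdeal A)
    exact hprime Q hQ (hbot ▸ bot_le)
  · exact hprime Q (by simpa using hQ) hle

theorem isField_of_ringKrullDim_eq_zero [IsRegularLocalRing A] (hA : ringKrullDim A = 0) :
    IsField A := by
  have h := (isRegularLocalRing_iff A).1 ‹_›
  rw [hA] at h
  have h0 : (maximalIdeal A).spanFinrank = 0 := by exact_mod_cast h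
  exact isField_iff_maximalIdeal_eq.2 ((Submodule.spanFinrank_eq_zero_iff_eq_bot
    (maximalIdeal A).fg_of_isNoetherianRing).1 h0)

/-- By induction `(x)` is prime. A minimal prime `Q ⊆ (x)` avoiding `x` satisfies `Q = xQ`, so `Q =
0` by Nakayama. -/
theorem isDomain_of_ringKrullDim_eq (n : ℕ) : ∀ {A : Type*} [CommRing A] [IsRegularLocalRing A],
    ringKrullDim A = n → IsDomain A := by
  induction n with
  | zero =>
    intro A _ _ hA
    exact (isField_of_ringKrullDim_eq_zero hA).isDomain
  | succ n ih =>
    intro A _ _ hA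
    obtain ⟨x, hx, hx2, hmin⟩ := exists_mem_maximalIdeal_notMem hA
    obtain ⟨hreg, hdim⟩ := quotient_span_singleton hA hx hx2
    have hprime : (Ideal.span {x}).IsPrime :=
      (Ideal.Quotient.isDomain_iff_prime _).1 (ih hdim)
    obtain ⟨Q, hQ, hQx⟩ := Ideal.exists_minimalPrimes_le (bot_le : (⊥ : Ideal A) ≤ Ideal.span {x})
    have hQp : Q.IsPrime := hQ.1.1
    have hQ0 : Q = ⊥ := by
      refine Submodule.eq_bot_of_le_smul_of_le_jacobson_bot (Ideal.span {x}) _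
        Q.fg_of_isNoetherianRing ?_ ((Ideal.span_singleton_le_iff_mem _).2
          (maximalIdeal_le_jacobson _ hx))
      intro y hy
      obtain ⟨z, rfl⟩ := Ideal.mem_span_singleton.1 (hQx hy)
      rw [smul_eq_mul]
      exact Ideal.mul_mem_mul (Ideal.mem_span_singleton_self x)
        ((hQp.mem_or_mem hy).resolve_left (hmin Q hQ))
    exact IsDomain.of_bot_isPrime A (hbp := hQ0 ▸ hQp)

instance isDomain [IsRegularLocalRing A] : IsDomain A :=
  isDomain_of_ringKrullDim_eq _ ((isRegularLocalRing_iff A).1 ‹_›).symm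

theorem exists_quotient_span_singleton [IsRegularLocalRing A] {n : ℕ}
    (hA : ringKrullDim A = (n + 1 : ℕ)) :
    ∃ x ∈ maximalIdeal A, x ≠ 0 ∧ IsRegularLocalRing (A ⧸ Ideal.span {x}) ∧
      ringKrullDim (A ⧸ Ideal.span {x}) = n := by
  obtain ⟨x, hx, hx2, -⟩ := exists_mem_maximalIdeal_notMem hA
  exact ⟨x, hx, fun h => hx2 (h ▸ zero_mem _), quotient_span_singleton hA hx hx2⟩

/-- The maximal ideal of a regular local ring of depth at most one is principal. -/
theorem isPrincipal_maximalIdeal_of_forall_mul_mem [IsRegularLocalRing A] {a c : A} (ha : a ≠ 0)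
    (hc : ¬ a ∣ c) (h : ∀ z ∈ maximalIdeal A, a ∣ z * c) : (maximalIdeal A).IsPrincipal := by
  have hdim := ((isRegularLocalRing_iff A).1 ‹_›).symm
  rcases hn : (maximalIdeal A).spanFinrank with _ | n
  · rw [(Submodule.spanFinrank_eq_zero_iff_eq_bot
      (maximalIdeal A).fg_of_isNoetherianRing).1 hn]
    infer_instance
  rw [hn] at hdim
  obtain ⟨x, hx, hx0, hreg, -⟩ := exists_quotient_span_singleton hdim
  have hxp : Prime x := (Ideal.span_singleton_prime hx0).1
    ((Ideal.Quotient.isDomain_iff_prime _).1 inferInstance)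
  refine ⟨x, le_antisymm (fun y hy => Ideal.mem_span_singleton.2 ?_)
    ((Ideal.span_singleton_le_iff_mem _).2 hx)⟩
  by_contra hxy
  -- From `x c = a u` and `y c = a v` follows `u y = x v`; the prime `x` does not divide `y`, so it
  -- divides `u`, whence `a ∣ c`.
  obtain ⟨u, hu⟩ := h x hx
  obtain ⟨v, hv⟩ := h y hy
  have huv : u * y = x * v := mul_left_cancel₀ ha (by linear_combination x * hv - y * hu)
  obtain ⟨w, rfl⟩ := (hxp.dvd_or_dvd ⟨v, huv⟩).resolve_right hxy
  exact hc ⟨w, mul_left_cancel₀ hx0 (by linear_combination hu)⟩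

end IsRegularLocalRing

/-! ### Freeness of Frobenius on regular local rings -/

namespace FrobPush

open IsLocalRing

theorem charP_quotient {A : Type*} [CommRing A] {p : ℕ} [hp : Fact p.Prime] [CharP A p]
    (I : Ideal A) [Nontrivial (A ⧸ I)] : CharP (A ⧸ I) p := by
  refine ringChar.of_eq (CharP.ringChar_of_prime_eq_zero hp.out ?_)
  rw [← map_natCast (Ideal.Quotient.mk I), CharP.cast_eq_zero, map_zero]

theorem mk_sum_pow_mul {p e : ℕ} {A : Type*} [CommRing A] [ExpChar A p] (I : Ideal A)
    [ExpChar (A ⧸ I) p] {ι : Type*} [Fintype ι] (r b : ι → A) :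
    of p e (A ⧸ I) (Ideal.Quotient.mk I (∑ i, r i ^ p ^ e * b i)) =
      ∑ i, Ideal.Quotient.mk I (r i) • of p e (A ⧸ I) (Ideal.Quotient.mk I (b i)) := by
  simp only [map_sum, smul_of, map_mul, map_pow]

section Lift

variable {p e : ℕ} {A : Type*} [CommRing A] [ExpChar A p] {x : A}
  [ExpChar (A ⧸ Ideal.span {x}) p] {ι : Type*} [Fintype ι] {b : ι → A}

theorem dvd_of_dvd_sum_pow_mul
    (hb : LinearIndependent (A ⧸ Ideal.span {x})
      fun i => of p e (A ⧸ Ideal.span {x}) (Ideal.Quotient.mk _ (b i)))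
    {r : ι → A} (h : x ∣ ∑ i, r i ^ p ^ e * b i) (i : ι) : x ∣ r i := by
  rw [← Ideal.mem_span_singleton, ← Ideal.Quotient.eq_zero_iff_mem] at h ⊢
  refine Fintype.linearIndependent_iff.1 hb (fun i => Ideal.Quotient.mk _ (r i)) ?_ i
  rw [← mk_sum_pow_mul, h, map_zero]

theorem exists_eq_sum_pow_mul_add_mul
    (hb : ⊤ ≤ Submodule.span (A ⧸ Ideal.span {x}) (Set.range
      fun i => of p e (A ⧸ Ideal.span {x}) (Ideal.Quotient.mk _ (b i)))) (a : A) :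
    ∃ (r : ι → A) (a' : A), a = ∑ i, r i ^ p ^ e * b i + x * a' := by
  obtain ⟨c, hc⟩ := (Submodule.mem_span_range_iff_exists_fun _).1
    (hb (Submodule.mem_top (x := of p e _ (Ideal.Quotient.mk _ a))))
  choose r hr using fun i => Ideal.Quotient.mk_surjective (c i)
  simp only [← hr] at hc
  rw [← mk_sum_pow_mul] at hc
  obtain ⟨a', ha'⟩ := Ideal.mem_span_singleton.1 (Ideal.Quotient.eq.1 ((of p e _).injective hc.symm))
  exact ⟨r, a', by linear_combination ha'⟩

/-- Modulo `x ^ (j + 1)` only the `j`-th term survives: later ones carry a higher power of `x`, and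
earlier ones are divisible by `x ^ p ^ e` by induction. -/
theorem dvd_of_sum_eq_zero [IsDomain A] (hx : x ≠ 0)
    (hb : LinearIndependent (A ⧸ Ideal.span {x})
      fun i => of p e (A ⧸ Ideal.span {x}) (Ideal.Quotient.mk _ (b i)))
    {g : ι → Fin (p ^ e) → A}
    (h : ∑ j, (∑ i, g i j ^ p ^ e * b i) * x ^ (j : ℕ) = 0) (j : Fin (p ^ e)) (i : ι) :
    x ∣ g i j := by
  induction j using WellFoundedLT.induction generalizing i with
  | ind j ih =>
    refine dvd_of_dvd_sum_pow_mul hb (r := fun i => g i j) ?_ i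
    rw [← mul_dvd_mul_iff_right (pow_ne_zero (j : ℕ) hx), ← pow_succ']
    rw [← Finset.add_sum_erase _ _ (Finset.mem_univ j)] at h
    rw [eq_neg_of_add_eq_zero_left h, dvd_neg]
    refine Finset.dvd_sum fun j' hj' => ?_
    rcases lt_or_gt_of_ne (Finset.ne_of_mem_erase hj') with hlt | hgt
    · refine Dvd.dvd.mul_right (Finset.dvd_sum fun i' _ => Dvd.dvd.mul_right ?_ _) _
      exact (pow_dvd_pow x j.isLt).trans (pow_dvd_pow_of_dvd (ih j' hlt i') _)
    · exact Dvd.dvd.mul_left (pow_dvd_pow x hgt) _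

/-- Dividing the coefficients by `x` divides the relation by `x ^ p ^ e`, so the argument repeats.
-/
theorem pow_dvd_of_sum_eq_zero [IsDomain A] (hx : x ≠ 0)
    (hb : LinearIndependent (A ⧸ Ideal.span {x})
      fun i => of p e (A ⧸ Ideal.span {x}) (Ideal.Quotient.mk _ (b i))) (n : ℕ) :
    ∀ {g : ι → Fin (p ^ e) → A} (_ : ∑ j, (∑ i, g i j ^ p ^ e * b i) * x ^ (j : ℕ) = 0)
      (j : Fin (p ^ e)) (i : ι), x ^ n ∣ g i j := by
  induction n with
  | zero => simp
  | succ n ih =>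
    intro g h j i
    choose g' hg' using fun i j => dvd_of_sum_eq_zero hx hb h j i
    obtain ⟨c, hc⟩ := ih (g := g') (by
      refine (mul_eq_zero.1 (?_ : x ^ p ^ e * _ = 0)).resolve_left (pow_ne_zero _ hx)
      rw [← h, Finset.mul_sum]
      refine Finset.sum_congr rfl fun j _ => ?_
      rw [← mul_assoc, Finset.mul_sum]
      congr 1
      refine Finset.sum_congr rfl fun i _ => ?_
      rw [hg' i j, mul_pow, mul_assoc]) j i
    exact ⟨c, by rw [hg', hc, pow_succ']; ring⟩

end Lift

/-- If the `b i` lift a basis modulo `x`, the `b i * x ^ j` with `j < p ^ e` form a basis: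
independence by Krull intersection, spanning by Nakayama. -/
theorem free_of_free_quotient {p e : ℕ} {A : Type*} [CommRing A] [IsDomain A] [IsLocalRing A]
    [IsNoetherianRing A] [ExpChar A p] [Module.Finite A (FrobPush p e A)] {x : A}
    (hx : x ∈ maximalIdeal A) (hx0 : x ≠ 0) [ExpChar (A ⧸ Ideal.span {x}) p]
    [Module.Finite (A ⧸ Ideal.span {x}) (FrobPush p e (A ⧸ Ideal.span {x}))]
    [Nontrivial (A ⧸ Ideal.span {x})]
    [Module.Free (A ⧸ Ideal.span {x}) (FrobPush p e (A ⧸ Ideal.span {x}))] :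
    Module.Free A (FrobPush p e A) := by
  let B := Module.Free.chooseBasis (A ⧸ Ideal.span {x}) (FrobPush p e (A ⧸ Ideal.span {x}))
  choose b hb using fun i => Ideal.Quotient.mk_surjective ((of p e _).symm (B i))
  have hB : (fun i => of p e (A ⧸ Ideal.span {x}) (Ideal.Quotient.mk _ (b i))) = B := by
    funext i
    rw [hb, RingEquiv.apply_symm_apply]
  have hli := hB ▸ B.linearIndependent
  have hsp := (hB ▸ B.span_eq).ge
  let v : Module.Free.ChooseBasisIndex (A ⧸ Ideal.span {x}) (FrobPush p e (A ⧸ Ideal.span {x})) ×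
    Fin (p ^ e) → FrobPush p e A := fun ij => of p e A (b ij.1 * x ^ (ij.2 : ℕ))
  refine Module.Free.of_basis (Module.Basis.mk (v := v) ?_ ?_)
  · rw [Fintype.linearIndependent_iff]
    intro g hg ij
    have hg' : ∑ j, (∑ i, g (i, j) ^ p ^ e * b i) * x ^ (j : ℕ) = 0 := by
      apply (of p e A).injective
      rw [map_zero, ← hg, Fintype.sum_prod_type_right]
      simp only [v, smul_of, map_sum, Finset.sum_mul]
      exact Finset.sum_congr rfl fun j _ => Finset.sum_congr rfl fun i _ => by rw [mul_assoc]
    have hmem : g ij ∈ ⨅ n : ℕ, Ideal.span {x} ^ n := by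
      rw [Ideal.mem_iInf]
      intro n
      rw [Ideal.span_singleton_pow, Ideal.mem_span_singleton]
      exact pow_dvd_of_sum_eq_zero (g := fun i j => g (i, j)) hx0 hli n hg' ij.2 ij.1
    rwa [Ideal.iInf_pow_eq_bot_of_isDomain _
      (Ideal.Quotient.nontrivial_iff.1 inferInstance)] at hmem
  · set S := Submodule.span A (Set.range v)
    -- An `x`-adic expansion to order `m`; at `m = p ^ e` the remainder is `x • F^e_* a'`.
    have key : ∀ m ≤ p ^ e, ∀ a : A, ∃ s ∈ S, ∃ a', of p e A a = s + of p e A (x ^ m * a') := by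
      intro m
      induction m with
      | zero => exact fun _ a => ⟨0, zero_mem _, a, by simp⟩
      | succ m ih =>
        intro hm a
        obtain ⟨s, hs, a', ha'⟩ := ih (by omega) a
        obtain ⟨r, a'', ha''⟩ := exists_eq_sum_pow_mul_add_mul hsp a'
        refine ⟨s + ∑ i, r i • v (i, ⟨m, hm⟩), add_mem hs (sum_mem fun i _ =>
          S.smul_mem _ (Submodule.subset_span ⟨_, rfl⟩)), a'', ?_⟩
        rw [ha', ha'', add_assoc]
        congr 1
        simp only [v, smul_of, ← map_sum, ← map_add]
        congr 1
        rw [mul_add, Finset.mul_sum]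
        congr 1
        · exact Finset.sum_congr rfl fun i _ => by ring
        · ring
    refine Submodule.le_of_le_smul_of_le_jacobson_bot Module.Finite.fg_top
      (maximalIdeal_le_jacobson _) fun y _ => ?_
    obtain ⟨s, hs, a', ha'⟩ := key _ le_rfl ((of p e A).symm y)
    rw [RingEquiv.apply_symm_apply, ← smul_of] at ha'
    rw [ha']
    exact Submodule.add_mem_sup hs (Submodule.smul_mem_smul hx Submodule.mem_top)

theorem finite_quotient {p e : ℕ} {A : Type*} [CommRing A] [ExpChar A p]
    [Module.Finite A (FrobPush p e A)] (I : Ideal A) [ExpChar (A ⧸ I) p] :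
    Module.Finite (A ⧸ I) (FrobPush p e (A ⧸ I)) := by
  obtain ⟨n, s, hs⟩ := Module.Finite.exists_fin (R := A) (M := FrobPush p e A)
  let b : Fin n → A := fun i => (of p e A).symm (s i)
  suffices h : ⊤ ≤ Submodule.span (A ⧸ I)
      (Set.range fun i => of p e (A ⧸ I) (Ideal.Quotient.mk I (b i))) from
    ⟨top_le_iff.1 h ▸ Submodule.fg_span (Set.finite_range _)⟩
  intro y _
  obtain ⟨a, ha⟩ := Ideal.Quotient.mk_surjective ((of p e _).symm y)
  obtain ⟨c, hc⟩ := (Submodule.mem_span_range_iff_exists_fun _).1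
    (hs.ge (Submodule.mem_top (x := of p e A a)))
  refine (Submodule.mem_span_range_iff_exists_fun _).2 ⟨fun i => Ideal.Quotient.mk I (c i), ?_⟩
  have h : ∑ i, c i ^ p ^ e * b i = a := by
    apply (of p e A).injective
    rw [← hc, map_sum]
    rfl
  rw [← mk_sum_pow_mul, h, ha, RingEquiv.apply_symm_apply]

/-- One direction of Kunz's theorem, for an `F`-finite ring: the Frobenius of a regular local ring
is free. -/
theorem free_of_isRegularLocalRing {p e : ℕ} [Fact p.Prime] {A : Type*} [CommRing A] [CharP A p]
    [IsRegularLocalRing A] [Module.Finite A (FrobPush p e A)] :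
    Module.Free A (FrobPush p e A) := by
  obtain ⟨n, hn⟩ : ∃ n : ℕ, ringKrullDim A = n :=
    ⟨_, ((isRegularLocalRing_iff A).1 ‹_›).symm⟩
  induction n generalizing A with
  | zero =>
    let := (IsRegularLocalRing.isField_of_ringKrullDim_eq_zero hn).toField
    exact Module.Free.of_divisionRing A _
  | succ n ih =>
    obtain ⟨x, hx, hx0, hreg, hdim⟩ := IsRegularLocalRing.exists_quotient_span_singleton hn
    have := charP_quotient (p := p) (Ideal.span {x})
    have := finite_quotient (p := p) (e := e) (Ideal.span {x})
    have := ih hdim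
    exact free_of_free_quotient hx hx0

end FrobPush

/-! ### `F`-finiteness -/

namespace FrobPush

/-- A ring essentially of finite type over a perfect field is `F`-finite. -/
theorem finite_of_essFiniteType {k : Type*} [Field k] [PerfectField k] {p : ℕ} [Fact p.Prime]
    [CharP k p] {R : Type*} [CommRing R] [CharP R p] [Algebra k R] [Algebra.EssFiniteType k R]
    (e : ℕ) : Module.Finite R (FrobPush p e R) := by
  let _ : Algebra R (FrobPush p e R) :=
    Algebra.ofModule (fun r x y => mul_assoc _ x y) (fun r x y => mul_left_comm x _ y)
  have smul_def (r x : R) : r • of p e R x = of p e R (r ^ p ^ e * x) := rfl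
  have algebraMap_def (r : R) : algebraMap R (FrobPush p e R) r = of p e R (r ^ p ^ e) := by
    rw [Algebra.algebraMap_eq_smul_one, ← map_one (of p e R), smul_def, mul_one]
  obtain ⟨σ, hσ⟩ := (Algebra.essFiniteType_iff k R).1 ‹_›
  have hft : Algebra.FiniteType R (FrobPush p e R) := by
    classical
    refine ⟨⟨σ.image (of p e R), top_le_iff.1 fun y _ => ?_⟩⟩
    set T := Algebra.adjoin R (↑(σ.image (of p e R)) : Set (FrobPush p e R))
    have hmem : ∀ a ∈ Algebra.adjoin k (σ : Set R), of p e R a ∈ T := by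
      intro a ha
      induction ha using Algebra.adjoin_induction with
      | mem a ha => exact Algebra.subset_adjoin (by simpa using ha)
      | algebraMap c =>
        have : PerfectRing k p := PerfectField.toPerfectRing p
        obtain ⟨d, rfl⟩ := (bijective_iterateFrobenius k p e).2 c
        rw [iterateFrobenius_def, map_pow, ← algebraMap_def]
        exact T.algebraMap_mem _
      | add a b _ _ ha hb => rw [map_add]; exact add_mem ha hb
      | mul a b _ _ ha hb => rw [map_mul]; exact mul_mem ha hb
    obtain ⟨t, ht, ⟨u, rfl⟩, hst⟩ := hσ ((of p e R).symm y)
    -- Clears the denominator `u`: the scalar `u⁻¹` acts as `u ^ (-p ^ e)`, leaving the numerator `y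
    -- u` times `u ^ (p ^ e - 1)`.
    have hy : y = (↑u⁻¹ : R) • (of p e R ((of p e R).symm y * u) *
        of p e R (u : R) ^ (p ^ e - 1)) := by
      rw [← map_pow, ← map_mul, smul_def, mul_assoc, ← pow_succ',
        Nat.sub_add_cancel (Nat.one_le_pow _ _ (Fact.out : p.Prime).pos), mul_left_comm,
        ← mul_pow, Units.inv_mul, one_pow, mul_one, RingEquiv.apply_symm_apply]
    rw [hy]
    exact T.smul_mem (mul_mem (hmem _ hst) (pow_mem (hmem _ ht) _)) _
  have hint : Algebra.IsIntegral R (FrobPush p e R) := by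
    refine ⟨fun y => IsIntegral.of_pow (pow_pos (Fact.out : p.Prime).pos e) ?_⟩
    have : y ^ p ^ e = algebraMap R _ ((of p e R).symm y) := by
      rw [algebraMap_def, map_pow, RingEquiv.apply_symm_apply]
    rw [this]
    exact isIntegral_algebraMap
  exact Algebra.IsIntegral.finite

end FrobPush

/-! ### Generation by `φ` off the divisor and the singular locus -/

/-- If the colon ideal `(a : c)` lies in a prime `P`, then some prime `Q ⊆ P` containing it is of
the form `(a : c')`. -/
theorem exists_isPrime_le_forall_mem_iff_dvd_mul {R : Type*} [CommRing R] [IsNoetherianRing R]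
    {a c : R} {P : Ideal R} [P.IsPrime] (h : ∀ z, a ∣ z * c → z ∈ P) :
    ∃ (Q : Ideal R) (w : R), Q.IsPrime ∧ Q ≤ P ∧ (∀ z, a ∣ z * c → z ∈ Q) ∧
      ∀ z, z ∈ Q ↔ a ∣ z * (w * c) := by
  set I : Ideal R := (Ideal.span {a}).colon {c} with hI
  have hmem : ∀ z, z ∈ I ↔ a ∣ z * c := fun z => by
    rw [hI, Submodule.mem_colon_singleton, smul_eq_mul, Ideal.mem_span_singleton]
  obtain ⟨Q, hQ, hQP⟩ := Ideal.exists_minimalPrimes_le (fun z hz => h z ((hmem z).1 hz) : I ≤ P)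
  have hass : Q ∈ associatedPrimes R (R ⧸ I) := by
    refine Module.associatedPrimes.minimalPrimes_annihilator_subset_associatedPrimes R _ ?_
    rwa [Ideal.annihilator_quotient]
  obtain ⟨hQp, x, hx⟩ := (isAssociatedPrime_iff).1 hass
  obtain ⟨w, rfl⟩ := Ideal.Quotient.mk_surjective x
  refine ⟨Q, w, hQp, hQP, fun z hz => hQ.1.2 ((hmem z).2 hz), fun z => ?_⟩
  rw [hx, Submodule.mem_colon_singleton, Submodule.mem_bot, ← mul_assoc, ← hmem,
    ← Ideal.Quotient.eq_zero_iff_mem, map_mul]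
  rfl

/-- A prime of a domain that is an associated prime of a principal ideal, and at which the ring is
regular, has height one, and the local ring is normal. -/
theorem height_eq_one_of_forall_mem_iff_dvd_mul {R : Type*} [CommRing R] [IsDomain R]
    {Q : Ideal R} [Q.IsPrime] [IsRegularLocalRing (Localization.AtPrime Q)] {a c : R} (ha : a ≠ 0)
    (h : ∀ z, z ∈ Q ↔ a ∣ z * c) :
    Q.height = 1 ∧ IsIntegrallyClosed (Localization.AtPrime Q) := by
  have hinj := IsLocalization.injective (Localization.AtPrime Q) Q.primeCompl_le_nonZeroDivisors
  have haQ : a ∈ Q := (h a).2 (dvd_mul_right _ _)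
  have hp : (IsLocalRing.maximalIdeal (Localization.AtPrime Q)).IsPrincipal := by
    refine IsRegularLocalRing.isPrincipal_maximalIdeal_of_forall_mul_mem
      (a := algebraMap R _ a) (c := algebraMap R _ c) ?_ ?_ ?_
    · rwa [Ne, map_eq_zero_iff _ hinj]
    · rintro ⟨d, hd⟩
      obtain ⟨⟨r, t⟩, hrt⟩ := IsLocalization.surj Q.primeCompl d
      refine t.2 ((h t).2 ⟨r, hinj ?_⟩)
      simp only [map_mul] at hrt ⊢
      rw [hd, ← hrt]
      ring
    · intro z hz
      obtain ⟨⟨r, t⟩, hrt⟩ := IsLocalization.surj Q.primeCompl z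
      have hr : r ∈ Q := by
        rw [← IsLocalization.AtPrime.to_map_mem_maximal_iff (Localization.AtPrime Q) Q, ← hrt]
        exact Ideal.mul_mem_right _ _ hz
      have hu := IsLocalization.map_units (Localization.AtPrime Q) t
      rw [← hu.dvd_mul_left (u := algebraMap R _ (t : R)), mul_left_comm, ← mul_assoc, hrt, ← map_mul]
      exact map_dvd _ ((h r).1 hr)
  have hpid : IsPrincipalIdealRing (Localization.AtPrime Q) :=
    ((tfae_of_isNoetherianRing_of_isLocalRing_of_isDomain (Localization.AtPrime Q)).out 0 4).2 hp
  have hf : ¬ IsField (Localization.AtPrime Q) := by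
    rw [IsLocalRing.isField_iff_maximalIdeal_eq]
    intro hbot
    have := (IsLocalization.AtPrime.to_map_mem_maximal_iff (Localization.AtPrime Q) Q a).2 haQ
    rw [hbot, Ideal.mem_bot, map_eq_zero_iff _ hinj] at this
    exact ha this
  refine ⟨?_, inferInstance⟩
  have h1 := IsPrincipalIdealRing.ringKrullDim_eq_one _ hf
  rw [IsLocalization.AtPrime.ringKrullDim_eq_height Q] at h1
  exact_mod_cast h1

theorem exists_smul_mem_span_of_sectionOrd_eq_zero {A M : Type*} [CommRing A] [AddCommGroup M]
    [Module A M] {s : M} {P : Ideal A} [P.IsPrime] (h : sectionOrd s P = 0) (m : M) :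
    ∃ r ∉ P, ∃ u : A, r • m = u • s := by
  obtain ⟨r, hr, hrm⟩ := LocalizedModule.subsingleton_iff.1 (Module.length_eq_zero_iff.1 h)
    (Submodule.Quotient.mk m)
  rw [← Submodule.Quotient.mk_smul, Submodule.Quotient.mk_eq_zero,
    Submodule.mem_span_singleton] at hrm
  obtain ⟨u, hu⟩ := hrm
  exact ⟨r, hr, u, hu.symm⟩

namespace FrobPush

/-- If all primes contained in `P` are regular points and `P` is not in the support of `D_φ`, then
`φ` generates `Hom_R(F^e_* R, R)` at `P`. -/
theorem exists_smul_eq_smul_of_notMem {p e : ℕ} {R : Type*} [CommRing R] [ExpChar R p] [IsDomain R]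
    [IsNoetherianRing R] [Module.Finite R (FrobPush p e R)] {φ : FrobPush p e R →ₗ[R] R}
    (hφ : φ ≠ 0) {P : PrimeSpectrum R} (hreg : ∀ Q ≤ P, Q ∉ singLocus R)
    (hdiv : P ∉ frobDivisorSupp φ) (ψ : FrobPush p e R →ₗ[R] R) :
    ∃ s u : R, s ∉ P.asIdeal ∧ of p e R s • ψ = of p e R u • φ := by
  by_contra! hcon
  obtain ⟨s₀, u₀, hs₀, h₀⟩ := exists_smul_eq_smul hφ ψ
  -- Identifies the `s` with `s • ψ` a multiple of `φ` as the colon ideal `(s₀ : u₀)`.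
  have key : ∀ s u : FrobPush p e R, s • ψ = u • φ ↔ s * u₀ = s₀ * u := by
    intro s u
    have h1 : s₀ • (s • ψ - u • φ) = (s * u₀ - s₀ * u) • φ := by
      rw [smul_sub, smul_smul, smul_smul, mul_comm s₀ s, mul_smul, h₀, sub_smul, mul_smul s u₀,
        mul_smul s₀ u]
    constructor
    · intro h
      rw [h, sub_self, smul_zero] at h1
      by_contra hne
      exact exists_smul_ne_zero hφ (sub_ne_zero.2 hne) h1.symm
    · intro h
      rw [h, sub_self, zero_smul] at h1
      by_contra hne
      exact exists_smul_ne_zero (sub_ne_zero.2 hne) hs₀ h1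
  obtain ⟨Q, w, hQ, hQP, hIQ, hQw⟩ := exists_isPrime_le_forall_mem_iff_dvd_mul
    (a := (of p e R).symm s₀) (c := (of p e R).symm u₀) (P := P.asIdeal) (by
      rintro z ⟨u, hu⟩
      by_contra hz
      refine hcon z u hz ((key _ _).2 ?_)
      simpa using congrArg (of p e R) hu)
  have hregQ : IsRegularLocalRing (Localization.AtPrime Q) := not_not.1 (hreg ⟨Q, hQ⟩ hQP)
  have hht := height_eq_one_of_forall_mem_iff_dvd_mul (Q := Q)
    (a := (of p e R).symm s₀) (by simpa using hs₀) hQw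
  let D : NormalPrimeDivisor R := ⟨⟨Q, hQ⟩, hht⟩
  have hD : frobDivisor φ D = 0 := by
    by_contra hne
    exact hdiv (Set.mem_iUnion₂.2 ⟨D, hne, hQP⟩)
  obtain ⟨r, hr, u, hru⟩ := exists_smul_mem_span_of_sectionOrd_eq_zero hD ψ
  refine hr (hIQ ((of p e R).symm r) ⟨(of p e R).symm u, ?_⟩)
  simpa using congrArg (of p e R).symm ((key _ _).1 hru)

end FrobPush

/-! ### Compatible ideals at good points -/

namespace FrobPush

/-- With `n = p ^ e - 1`, `s ψ(j) = ψ(s ^ p ^ e * j) = φ(u * s ^ n * j)`. -/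
theorem Compatible.mul_apply_mem {p e : ℕ} {R : Type*} [CommRing R] [ExpChar R p]
    {φ ψ : FrobPush p e R →ₗ[R] R} {J : Ideal R} (h : Compatible φ J) {s u : R}
    (hs : of p e R s • ψ = of p e R u • φ) {j : R} (hj : j ∈ J) : s * ψ (of p e R j) ∈ J := by
  obtain ⟨n, hn⟩ := Nat.exists_eq_succ_of_ne_zero (pow_pos (expChar_pos R p) e).ne'
  have h1 := LinearMap.congr_fun hs (of p e R (s ^ n * j))
  rw [smul_hom_apply, smul_hom_apply, ← map_mul, ← map_mul, ← mul_assoc, ← pow_succ',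
    ← Nat.succ_eq_add_one, ← hn, apply_pow_mul] at h1
  rw [h1]
  exact compatible_iff.1 h _ (J.mul_mem_left _ (J.mul_mem_left _ hj))

/-- A linear form on the Frobenius push-forward of a localization, restricted to `F^e_* R`. -/
def restrictHom {p e : ℕ} {R : Type*} [CommRing R] [ExpChar R p] {A : Type*} [CommRing A]
    [ExpChar A p] [Algebra R A] (ψ : FrobPush p e A →ₗ[A] A) : FrobPush p e R →ₗ[R] A where
  toFun x := ψ (of p e A (algebraMap R A ((of p e R).symm x)))
  map_add' x y := by simp only [map_add]
  map_smul' r x := by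
    have h : (of p e R).symm (r • x) = r ^ p ^ e * (of p e R).symm x := rfl
    rw [h, map_mul, map_pow, apply_pow_mul, RingHom.id_apply, Algebra.smul_def]

theorem Compatible.eq_bot_of_le {p e : ℕ} [Fact p.Prime] (he : 0 < e) {R : Type*} [CommRing R]
    [CharP R p] [IsDomain R] [IsNoetherianRing R] [Module.Finite R (FrobPush p e R)]
    {φ : FrobPush p e R →ₗ[R] R} {J : Ideal R} (hJ : Compatible φ J) {P : Ideal R} [P.IsPrime]
    [IsRegularLocalRing (Localization.AtPrime P)] [CharP (Localization.AtPrime P) p]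
    [Module.Finite (Localization.AtPrime P) (FrobPush p e (Localization.AtPrime P))]
    (hgen : ∀ ψ : FrobPush p e R →ₗ[R] R, ∃ s u : R, s ∉ P ∧ of p e R s • ψ = of p e R u • φ)
    (hJP : J ≤ P) : J = ⊥ := by
  set A := Localization.AtPrime P
  have hinj : Function.Injective (algebraMap R A) :=
    IsLocalization.injective A P.primeCompl_le_nonZeroDivisors
  have hpe : 2 ≤ p ^ e :=
    (Fact.out : p.Prime).two_le.trans (Nat.le_self_pow he.ne' p)
  have : Module.Free A (FrobPush p e A) := free_of_isRegularLocalRing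
  let B := Module.Free.chooseBasis A (FrobPush p e A)
  have hfp : Module.FinitePresentation R (FrobPush p e R) :=
    Module.finitePresentation_of_finite R _
  -- By finite presentation each coordinate function is, up to a unit of `A`, induced by an
  -- `R`-linear `h : F^e_* R → R`, to which `hgen` applies.
  have hcoord : ∀ i, ∀ j ∈ J, B.repr (of p e A (algebraMap R A j)) i ∈ J.map (algebraMap R A) := by
    intro i j hj
    obtain ⟨h, s, hs⟩ := Module.FinitePresentation.exists_lift_of_isLocalizedModule P.primeCompl
      (Algebra.linearMap R A) (restrictHom (B.coord i) : FrobPush p e R →ₗ[R] A)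
    obtain ⟨t, u, ht, htu⟩ := hgen h
    have hmem := Ideal.mem_map_of_mem (algebraMap R A) (hJ.mul_apply_mem htu hj)
    have hsj : algebraMap R A (h (of p e R j)) =
        algebraMap R A s * B.repr (of p e A (algebraMap R A j)) i :=
      (LinearMap.congr_fun hs (of p e R j)).trans (Algebra.smul_def (s : R) _)
    rw [map_mul, hsj] at hmem
    exact (Ideal.unit_mul_mem_iff_mem _ (IsLocalization.map_units A s)).1
      ((Ideal.unit_mul_mem_iff_mem _ (IsLocalization.map_units A
        (⟨t, ht⟩ : P.primeCompl))).1 hmem)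
  -- Expanding in the basis, the coordinates enter to the power `p ^ e ≥ 2`.
  have hsq : J.map (algebraMap R A) ≤ J.map (algebraMap R A) ^ 2 := by
    rw [Ideal.map_le_iff_le_comap]
    intro j hj
    have hsum : algebraMap R A j = ∑ i, B.repr (of p e A (algebraMap R A j)) i ^ p ^ e *
        (of p e A).symm (B i) := by
      apply (of p e A).injective
      rw [map_sum]
      exact (B.sum_repr (of p e A (algebraMap R A j))).symm
    rw [Ideal.mem_comap, hsum]
    exact Ideal.sum_mem _ fun i _ => Ideal.mul_mem_right _ _
      (Ideal.pow_le_pow_right hpe (Ideal.pow_mem_pow (hcoord i j hj) _))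
  have hle : J.map (algebraMap R A) ≤ IsLocalRing.maximalIdeal A := by
    rw [← Localization.AtPrime.map_eq_maximalIdeal]
    exact Ideal.map_mono hJP
  have hbot : J.map (algebraMap R A) = ⊥ := by
    refine Submodule.eq_bot_of_le_smul_of_le_jacobson_bot (J.map (algebraMap R A)) _
      (IsNoetherian.noetherian _) ?_ (hle.trans (IsLocalRing.maximalIdeal_le_jacobson _))
    rwa [smul_eq_mul, ← pow_two]
  exact (Ideal.map_eq_bot_iff_of_injective hinj).1 hbot

end FrobPush

/-! ### Assembly -/

theorem mainTheorem5 {k : Type*} [Field k] [PerfectField k] {p : ℕ} [Fact p.Prime] [CharP k p]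
    {R : Type*} [CommRing R] [CharP R p] [Algebra k R] [Algebra.EssFiniteType k R]
    {e : ℕ} (he : 0 < e) (φ : FrobPush p e R →ₗ[R] R) :
    (∀ J : Ideal R, FrobPush.Compatible φ J →
      ∀ t : ℕ, 0 < t → FrobPush.Compatible (FrobPush.iter φ t) J) ∧
    (Function.Surjective φ → ∀ t : ℕ, 0 < t → ∀ J : Ideal R,
      FrobPush.Compatible (FrobPush.iter φ t) J → FrobPush.Compatible φ J) ∧
    (Function.Surjective φ → IsDomain R → ∀ a : Ideal R, a ≠ ⊥ →
      frobDivisorSupp φ ∪ singLocus R ⊆ PrimeSpectrum.zeroLocus (a : Set R) →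
      (∀ t : ℕ, 0 < t →
        FrobPush.image (FrobPush.iter φ t) a ≤ FrobPush.image (FrobPush.iter φ (t + 1)) a) ∧
      ∃ C : Ideal R, IsLeast {J : Ideal R | J ≠ ⊥ ∧ FrobPush.Compatible φ J} C ∧
        ∃ N : ℕ, 0 < N ∧ ∀ t : ℕ, N ≤ t → FrobPush.image (FrobPush.iter φ t) a = C) := by
  refine ⟨fun J hJ t _ => hJ.iter t, fun hφ t ht J hJ =>
    FrobPush.compatible_of_compatible_iter hφ ht hJ, fun hφ _ a ha hsupp => ?_⟩
  have hnoeth : IsNoetherianRing R := Algebra.EssFiniteType.isNoetherianRing k R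
  have hfin : Module.Finite R (FrobPush p e R) := FrobPush.finite_of_essFiniteType (k := k) e
  have hmono := FrobPush.monotone_image_iter hφ a
  refine ⟨fun t _ => hmono t.le_succ, ?_⟩
  obtain ⟨n, hn⟩ := monotone_stabilizes_iff_noetherian.2 hnoeth
    ⟨fun t => FrobPush.image (FrobPush.iter φ t) a, hmono⟩
  simp only [OrderHom.coe_mk] at hn
  have hφ0 : φ ≠ 0 := by
    rintro rfl
    obtain ⟨y, hy⟩ := hφ 1
    exact zero_ne_one hy
  have hpe : 1 < p ^ e := Nat.one_lt_pow he.ne' (Fact.out : p.Prime).one_lt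
  refine ⟨FrobPush.image (FrobPush.iter φ n) a, ⟨⟨?_, ?_⟩, ?_⟩, n + 1, n.succ_pos,
    fun t ht => (hn t (by omega)).symm⟩
  · intro hbot
    refine ha (le_bot_iff.1 (hbot ▸ ?_))
    simpa only [FrobPush.image_iter_zero] using hmono n.zero_le
  · exact ((FrobPush.image_iter_succ φ n a).symm.trans (hn (n + 1) n.le_succ).symm).le
  · rintro J ⟨hJ0, hJ⟩
    suffices haJ : a ≤ J from (FrobPush.image_mono _ haJ).trans (hJ.iter n)
    rw [← (hJ.isRadical hφ hpe).radical, Ideal.radical_eq_sInf]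
    refine le_sInf fun P ⟨hJP, hP⟩ => ?_
    by_contra haP
    -- The complement of `V(a)` is stable under generization.
    have hQ : ∀ Q ≤ (⟨P, hP⟩ : PrimeSpectrum R), Q ∉ frobDivisorSupp φ ∪ singLocus R :=
      fun Q hQP hQ => haP ((hsupp hQ : a ≤ Q.asIdeal).trans hQP)
    have hreg : IsRegularLocalRing (Localization.AtPrime P) :=
      not_not.1 fun h => hQ _ le_rfl (Or.inr h)
    have hchar : CharP (Localization.AtPrime P) p := charP_of_injective_algebraMap
      (IsLocalization.injective _ P.primeCompl_le_nonZeroDivisors : Function.Injective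
        (algebraMap R (Localization.AtPrime P))) p
    have hfinP : Module.Finite (Localization.AtPrime P) (FrobPush p e (Localization.AtPrime P)) :=
      FrobPush.finite_of_essFiniteType (k := k) e
    refine hJ0 (hJ.eq_bot_of_le he (P := P) (fun ψ => ?_) hJP)
    exact FrobPush.exists_smul_eq_smul_of_notMem hφ0 (P := ⟨P, hP⟩)
      (fun Q hQP h => hQ Q hQP (Or.inr h)) (fun h => hQ _ le_rfl (Or.inl h)) ψ
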